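/- Let $n,k\ge 0$ be integers. Let $\Delta_n$ be the triangular Ferrers shape (French notation, left-justified) with $n$ cells in the bottom row, $n-1$ cells in the row above it, and so on, up to one cell in the topmost row. A 01-filling of $\Delta_n$ assigns $0$ or $1$ to every cell; an NE-chain of length $\ell$ is a sequence of $\ell$ cells filled with $1$, each strictly above and weakly to the right of the preceding one. A partition $\lambda=(\lambda_1\ge\lambda_2\ge\cdots)$ is identified with its Ferrers diagram (with $\lambda_r$ squares in the $r$-th row; its number of columns is $\lambda_1$), and a horizontal strip is a set of squares no two of which are in the same column. Then the 01-fillings of $\Delta_n$ with exactly one $1$ in every row and no NE-chain of length $k+1$ are in bijection with the sequences $(\emptyset=\lambda^0,\lambda^1,\ldots,\lambda^{2n}=\emptyset)$ of partitions, each with at most $k$ columns, such that for all $0\le i<n$ the partition $\lambda^{2i+1}$ is obtained from $\lambda^{2i}$ by doing nothing or by adding a horizontal strip, and $\lambda^{2i+2}$ is obtained from $\lambda^{2i+1}$ by deleting exactly one square. More precisely, the growth diagram gives such a bijection. Label the corners of the cells of $\Delta_n$ by partitions as follows. All corners on the left and bottom sides are labelled $\emptyset$. If a cell is filled with $m$ and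 its bottom-left, bottom-right and top-left corners are labelled $\rho$, $\mu$, $\upsilon$, then its top-right corner is labelled by the partition $\lambda$ with $\lambda_r=\max\{\mu_r+a_r,\upsilon_r\}$ for $r\ge 1$, where $a_1=m$ and $a_{r+1}=\min\{\mu_r+a_r,\upsilon_r\}-\rho_r$. The bijection sends a filling to the sequence of the labels of the corners along the right/up border of $\Delta_n$, read from top-left to bottom-right. -/

import Mathlib

namespace GrowthDiagram

/-- The triangular Ferrers shape with `n` cells in the bottom row, `n - 1` cells in the row above
it, ..., one cell in the topmost row. A cell is a pair (row, column), both counted from `0`; rows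
are counted from bottom to top (French notation) and columns from left to right. -/
def triangle (n : ℕ) : YoungDiagram where
  cells := (Finset.range n ×ˢ Finset.range n).filter fun c => c.1 + c.2 < n
  isLowerSet := by
    rintro ⟨a, b⟩ ⟨c, d⟩ h hab
    obtain ⟨h1, h2⟩ := Prod.mk_le_mk.1 h
    simp only [Finset.coe_filter, Finset.mem_product, Finset.mem_range, Set.mem_ofPred_eq] at hab ⊢
    omega

theorem mem_triangle {n : ℕ} {c : ℕ × ℕ} : c ∈ triangle n ↔ c.1 + c.2 < n := by
  rw [← YoungDiagram.mem_cells]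
  simp only [triangle, Finset.mem_filter, Finset.mem_product, Finset.mem_range]
  omega

/-- A 01-filling of a Ferrers shape: every cell is filled with `0` or `1`. -/
abbrev Filling (F : YoungDiagram) : Type := {c : ℕ × ℕ // c ∈ F} → Fin 2

/-- The number in the cell in row `i` and column `j` (and `0` if there is no such cell). -/
def entry {F : YoungDiagram} (M : Filling F) (i j : ℕ) : ℕ :=
  if h : (i, j) ∈ F then (M ⟨(i, j), h⟩ : ℕ) else 0

/-- A sequence of 1's, each strictly above and weakly to the right of the preceding one. -/
def IsNEChain {F : YoungDiagram} (M : Filling F) (l : List (ℕ × ℕ)) : Prop :=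
  (∀ c ∈ l, entry M c.1 c.2 = 1) ∧ l.IsChain fun a b => a.1 < b.1 ∧ a.2 ≤ b.2

/-- Every row of the triangular shape contains exactly one `1`. -/
def OneInEachRow {n : ℕ} (M : Filling (triangle n)) : Prop :=
  ∀ i < n, ∃! j, entry M i j = 1

/-- The value of CARRY when the forward algorithm treats the part with index `r` (parts are
indexed from `0`), for a cell filled with `m` whose bottom-left, bottom-right and top-left corners
are labelled by `ρ`, `μ` and `υ`. -/
def carry (m : ℕ) (ρ μ υ : ℕ → ℕ) : ℕ → ℕ
  | 0 => m
  | r + 1 => min (μ r + carry m ρ μ υ r) (υ r) - ρ r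

/-- The parts of the label of the top-right corner of a cell, by the forward algorithm. Partitions
are sequences of parts followed by infinitely many zeros; from the first `r` on at which the value
is `0` (where the algorithm stops), CARRY and all later values are `0`. -/
def forward (m : ℕ) (ρ μ υ : ℕ → ℕ) (r : ℕ) : ℕ :=
  max (μ r + carry m ρ μ υ r) (υ r)

/-- The labels of the growth diagram of a filling: `label M i j` is the sequence of parts of the
partition at the corner at height `i` and horizontal position `j`, so that the cell in row `i` and
column `j` has the bottom-left corner `(i, j)` and the top-right corner `(i + 1, j + 1)`. -/
def label {F : YoungDiagram} (M : Filling F) : ℕ → ℕ → ℕ → ℕ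
  | 0, _ => fun _ => 0
  | _ + 1, 0 => fun _ => 0
  | i + 1, j + 1 => forward (entry M i j) (label M i j) (label M i (j + 1)) (label M (i + 1) j)

/-- The labels along the right/up border of the triangular shape from top-left to bottom-right.
The border is `RDRD...RD`: its corner number `2 * i` is at height `n - i` and horizontal position
`i`, its corner number `2 * i + 1` is at height `n - i` and horizontal position `i + 1`. -/
def borderLabel {n : ℕ} (M : Filling (triangle n)) (t : ℕ) : ℕ → ℕ :=
  label M (n - t / 2) ((t + 1) / 2)

/-- `ν` is obtained from `μ` by adding a horizontal strip: no two of the added squares are in the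
same column. -/
def AddsHorizontalStrip (μ ν : YoungDiagram) : Prop :=
  μ ≤ ν ∧ ∀ c ∈ ν, c ∉ μ → ∀ d ∈ ν, d ∉ μ → c.2 = d.2 → c = d

/-- `ν` is obtained from `μ` by deleting exactly one square. -/
def DeletesSquare (μ ν : YoungDiagram) : Prop :=
  ∃ c ∈ μ, ν.cells = μ.cells.erase c

/-- The sequences `∅ = s 0, s 1, ..., s (2 * n) = ∅` of partitions with at most `k` columns in which
odd steps add nothing or a horizontal strip and even steps delete exactly one square. -/
structure IsStripSequence (n k : ℕ) (s : Fin (2 * n + 1) → YoungDiagram) : Prop where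
  first : s ⟨0, by omega⟩ = ⊥
  last : s ⟨2 * n, by omega⟩ = ⊥
  columns : ∀ t, (s t).rowLen 0 ≤ k
  odd_step : ∀ (i : ℕ) (hi : i < n),
    s ⟨2 * i + 1, by omega⟩ = s ⟨2 * i, by omega⟩ ∨
      AddsHorizontalStrip (s ⟨2 * i, by omega⟩) (s ⟨2 * i + 1, by omega⟩)
  even_step : ∀ (i : ℕ) (hi : i < n),
    DeletesSquare (s ⟨2 * i + 1, by omega⟩) (s ⟨2 * i + 2, by omega⟩)

end GrowthDiagram

namespace GrowthDiagram

/-! With at most one 1 in every row, each horizontal edge of the growth diagram adds a horizontal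
strip and each vertical edge adds at most one square. On such cells the local rule is simple. If `υ
= ρ`, the entry is added to the first part of `μ`. If `υ` is `ρ` plus a square in row `s`, then `m =
0`, and `ν` is `μ` plus a square in row `s`, bumped to row `s + 1` when `μ` already exceeds `ρ` in
row `s`. Comparing `ν` with `μ` and `υ` tells these cases apart, so the bottom-left label and the
entry can be recovered from the other three labels (`IsCell.eq_pullback`, `IsCell.of_top_right`).

Injectivity follows by peeling off cells from the border inwards. For surjectivity, the backward
rule extends a given border to the whole triangle. The labels on the left and bottom sides are
forced to be empty by containment. Along a row, the vertical edges start trivial and end with one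
square, and each changes type only at a 1, so the row has exactly one 1.

First parts obey the recurrence for longest NE-chains, so bounding the number of columns on the
border bounds the chains. -/

/-- The parts `b` arise from the parts `a` by adding a (possibly empty) horizontal strip. -/
def Strip (a b : ℕ → ℕ) : Prop := ∀ r, a r ≤ b r ∧ b (r + 1) ≤ a r

/-- The parts `b` arise from the parts `a` by adding one square. -/
def Incr (a b : ℕ → ℕ) : Prop := ∃ s, ∀ r, b r = a r + if r = s then 1 else 0

theorem Incr.ne {a b : ℕ → ℕ} (h : Incr a b) : b ≠ a := by
  obtain ⟨s, hs⟩ := h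
  intro e
  have := hs s
  simp [e] at this

theorem Strip.antitone_left {a b : ℕ → ℕ} (h : Strip a b) : Antitone a :=
  antitone_nat_of_succ_le fun r => (h (r + 1)).1.trans (h r).2

theorem Strip.antitone_right {a b : ℕ → ℕ} (h : Strip a b) : Antitone b :=
  antitone_nat_of_succ_le fun r => (h r).2.trans (h r).1

/-! ### The local rule -/

theorem forward_of_eq {m : ℕ} {ρ μ : ℕ → ℕ} (h : ∀ r, ρ r ≤ μ r) (r : ℕ) :
    forward m ρ μ ρ r = μ r + if r = 0 then m else 0 := by
  have hc : carry m ρ μ ρ r = if r = 0 then m else 0 := by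
    cases r with
    | zero => rfl
    | succ r => simp [carry]
  have := h r
  rw [forward, hc]
  omega

/-- The carry is nonzero only in row `s + 1`, and there only if row `s` of `μ` already exceeds that
of `ρ`: the row bumping of Robinson–Schensted. -/
theorem forward_of_incr {ρ μ υ : ℕ → ℕ} {s : ℕ} (h : Strip ρ μ)
    (hs : ∀ r, υ r = ρ r + if r = s then 1 else 0) (r : ℕ) :
    forward 0 ρ μ υ r = μ r + if r = (if μ s = ρ s then s else s + 1) then 1 else 0 := by
  have hc : ∀ r, carry 0 ρ μ υ r = if r = s + 1 ∧ ρ s < μ s then 1 else 0 := by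
    intro r
    induction r with
    | zero => simp [carry]
    | succ r ih =>
      rw [carry, ih, hs r]
      have := h r
      by_cases e : r = s
      · subst e
        simp
        split_ifs <;> omega
      · simp [e]
  rw [forward, hc, hs r]
  have h1 := h r
  have h2 := h s
  by_cases e : r = s
  · subst e
    split_ifs <;> omega
  · split_ifs <;> omega

/-- The bottom-left label of a cell, computed from the other three. -/
def pullback (μ υ ν : ℕ → ℕ) (r : ℕ) : ℕ :=
  if ν r ≠ μ r ∧ ν r = υ r ∨ ν (r + 1) ≠ μ (r + 1) ∧ ν (r + 1) ≠ υ (r + 1) then υ r - 1 else υ r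

/-- The entry of a cell, computed from all its labels but the bottom-left one. -/
def pullbackEntry (μ υ ν : ℕ → ℕ) : ℕ := if ν 0 ≠ μ 0 ∧ ν 0 ≠ υ 0 then 1 else 0

/-- A cell of a growth diagram in which vertical edges add at most one square. -/
structure IsCell (m : ℕ) (ρ μ υ ν : ℕ → ℕ) : Prop where
  le_one : m ≤ 1
  bottom : Strip ρ μ
  antitone : Antitone υ
  left : υ = ρ ∨ Incr ρ υ ∧ m = 0
  eq_forward : ν = forward m ρ μ υ

namespace IsCell

variable {m : ℕ} {ρ μ υ ν : ℕ → ℕ}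

theorem top (h : IsCell m ρ μ υ ν) : Strip υ ν := by
  obtain ⟨hm, hb, ha, hl, rfl⟩ := h
  rcases hl with rfl | ⟨⟨s, hs⟩, rfl⟩
  · intro r
    have h0 := hb r
    rw [forward_of_eq fun r => (hb r).1, forward_of_eq fun r => (hb r).1]
    simp
    omega
  · intro r
    have h0 := hb r
    have h2 := hb s
    have h1 := hb (r + 1)
    have h4 := ha (Nat.le_add_right r 1)
    rw [hs r, hs (r + 1)] at h4
    have h3 := hb.antitone_right (Nat.le_add_right r 1)
    rw [forward_of_incr hb hs, forward_of_incr hb hs, hs r]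
    by_cases e : r = s
    · subst e
      split_ifs <;> omega
    · by_cases e' : r + 1 = s
      · subst e'
        rw [if_pos rfl, if_neg (by omega)] at h4
        split_ifs <;> omega
      · split_ifs <;> omega

theorem right_of_incr (h : IsCell m ρ μ υ ν) (hi : Incr ρ υ) : m = 0 ∧ Incr μ ν := by
  obtain ⟨hm, hb, ha, hl, rfl⟩ := h
  rcases hl with rfl | ⟨⟨s, hs⟩, rfl⟩
  · exact absurd rfl hi.ne
  · exact ⟨rfl, _, forward_of_incr hb hs⟩

theorem right_of_zero (h : IsCell 0 ρ μ ρ ν) : ν = μ := by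
  obtain ⟨hm, hb, ha, hl, rfl⟩ := h
  funext r
  rw [forward_of_eq fun r => (hb r).1]
  simp

theorem right_of_one (h : IsCell 1 ρ μ υ ν) : υ = ρ ∧ Incr μ ν := by
  obtain ⟨hm, hb, ha, hl, rfl⟩ := h
  rcases hl with rfl | ⟨_, h⟩
  · exact ⟨rfl, 0, forward_of_eq fun r => (hb r).1⟩
  · omega

/-- Let `ν` exceed `μ` in row `p`. Then `ν p = υ p` means that the square was not bumped. Otherwise
it was bumped from row `p - 1`, or, for `p = 0`, it came from the entry. -/
theorem eq_pullback (h : IsCell m ρ μ υ ν) :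
    ρ = pullback μ υ ν ∧ m = pullbackEntry μ υ ν := by
  obtain ⟨hm, hb, ha, hl, rfl⟩ := h
  rcases hl with rfl | ⟨⟨s, hs⟩, rfl⟩
  · have hf := forward_of_eq (m := m) fun r => (hb r).1
    constructor
    · funext r
      have h0 := hb r
      rw [pullback, hf, hf, if_neg]
      by_cases e : r = 0
      · subst e
        simp
        omega
      · simp [e]
    · have h0 := hb 0
      rw [pullbackEntry, hf]
      simp
      split_ifs <;> omega
  · have hf := forward_of_incr hb hs
    constructor
    · funext r
      have h0 := hb r
      have h1 := hb (r + 1)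
      have h2 := hb s
      rw [pullback, hf, hf, hs r, hs (r + 1)]
      by_cases e : r = s
      · subst e
        by_cases e2 : μ r = ρ r <;> simp [e2]
        omega
      · by_cases e' : r + 1 = s
        · subst e'
          by_cases e2 : μ (r + 1) = ρ (r + 1) <;> simp [e2]
          split_ifs <;> omega
        · by_cases e2 : μ s = ρ s <;> simp [e2, e, e']
          split_ifs <;> omega
    · have h0 := hb 0
      have h2 := hb s
      rw [pullbackEntry, hf, hs 0]
      by_cases e : 0 = s
      · subst e
        split_ifs <;> omega
      · split_ifs <;> omega

theorem of_top_right (ht : Strip υ ν) (ha : Antitone μ) (hr : ν = μ ∨ Incr μ ν) :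
    IsCell (pullbackEntry μ υ ν) (pullback μ υ ν) μ υ ν := by
  rcases hr with rfl | ⟨s, hs⟩
  · have h1 : pullback ν υ ν = υ := by
      funext r
      simp [pullback]
    have h2 : pullbackEntry ν υ ν = 0 := by simp [pullbackEntry]
    rw [h1, h2]
    refine ⟨zero_le_one, ht, ht.antitone_left, Or.inl rfl, ?_⟩
    funext r
    rw [forward_of_eq fun r => (ht r).1]
    simp
  · have hμ : ∀ r, r ≠ s → ν r = μ r := fun r hr => by simpa [hr] using hs r
    have hμs : ν s = μ s + 1 := by simpa using hs s
    -- Here `p` is the row in which `υ` exceeds the bottom-left label. The last hypothesis says that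
    -- the forward rule puts the square back into row `s`.
    have key : ∀ p, (∀ r, υ r = pullback μ υ ν r + if r = p then 1 else 0) →
        Strip (pullback μ υ ν) μ → pullbackEntry μ υ ν = 0 →
        s = (if μ p = pullback μ υ ν p then p else p + 1) →
        IsCell (pullbackEntry μ υ ν) (pullback μ υ ν) μ υ ν := by
      intro p hp hst h0 hsp
      rw [h0]
      refine ⟨zero_le_one, hst, ht.antitone_left, Or.inr ⟨⟨p, hp⟩, rfl⟩, ?_⟩
      funext r
      rw [forward_of_incr hst hp, ← hsp, hs r]
    by_cases hυ : ν s = υ s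
    · have hp : ∀ r, pullback μ υ ν r = if r = s then υ r - 1 else υ r := by
        intro r
        by_cases e : r = s
        · subst e
          simp [pullback, hυ]
          omega
        · by_cases e' : r + 1 = s
          · subst e'
            simp [pullback, hμ r e, hυ]
          · simp [pullback, hμ r e, hμ _ e', e]
      refine key s ?_ ?_ ?_ ?_
      · intro r
        rw [hp]
        by_cases e : r = s
        · subst e
          simp
          omega
        · simp [e]
      · intro r
        rw [hp]
        have h1 := ht r
        have h2 := hs r
        have h3 := hs (r + 1)
        have h4 := hμ (r + 1)
        -- Needed in row `s`, where the bottom-left label equals `μ`.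
        have h5 := ha (Nat.le_add_right r 1)
        by_cases e : r = s
        · subst e
          simp at h2 h3 ⊢
          omega
        · rw [if_neg e] at h2 ⊢
          split_ifs at h3 <;> omega
      · by_cases e : 0 = s
        · subst e
          simp [pullbackEntry, hυ]
        · simp [pullbackEntry, hμ 0 e]
      · rw [hp]
        simp
        omega
    · by_cases e0 : s = 0
      · subst e0
        have h1 : pullback μ υ ν = υ := by
          funext r
          rw [pullback, if_neg]
          rw [hμ (r + 1) (by omega)]
          by_cases e : r = 0
          · subst e
            simp [hυ]
          · simp [hμ r e]
        have h2 : pullbackEntry μ υ ν = 1 := by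
          rw [pullbackEntry, if_pos ⟨by omega, hυ⟩]
        have h3 : Strip υ μ := by
          intro r
          have a1 := ht r
          have a2 := hs r
          have a3 := hs (r + 1)
          rw [if_neg (by omega)] at a3
          split_ifs at a2 with e
          · subst e
            omega
          · omega
        rw [h1, h2]
        refine ⟨le_rfl, h3, ht.antitone_left, Or.inl rfl, ?_⟩
        funext r
        rw [forward_of_eq fun r => (h3 r).1, hs r]
      · obtain ⟨p, rfl⟩ := Nat.exists_eq_succ_of_ne_zero e0
        simp only [Nat.succ_eq_add_one] at *
        have hp : ∀ r, pullback μ υ ν r = if r = p then υ r - 1 else υ r := by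
          intro r
          by_cases e : r = p
          · subst e
            rw [pullback, if_pos (Or.inr ⟨by omega, hυ⟩), if_pos rfl]
          · by_cases e' : r = p + 1
            · subst e'
              simp [pullback, hμ (p + 1 + 1) (by omega), hυ]
            · simp [pullback, hμ r e', hμ (r + 1) (by omega), e]
        -- `υ p ≥ ν (p + 1) > 0`, so the subtraction in row `p` is not truncated.
        have hb := ht p
        have hb' := ht (p + 1)
        have hm := hμ p (by omega)
        refine key p ?_ ?_ ?_ ?_
        · intro r
          rw [hp]
          by_cases e : r = p
          · subst e
            simp
            omega
          · simp [e]
        · intro r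
          rw [hp]
          have h1 := ht r
          have h2 := hs r
          have h3 := hs (r + 1)
          by_cases e : r = p
          · subst e
            simp at h2 h3 ⊢
            omega
          · simp [e] at h2 h3 ⊢
            split_ifs at h2 with h4
            · subst h4
              omega
            · omega
        · simp [pullbackEntry, hμ 0 (by omega)]
        · rw [hp]
          simp
          omega

end IsCell

/-! ### Labels of a filling -/

section Label

variable {F : YoungDiagram} {M : Filling F}

theorem entry_le_one (M : Filling F) (i j : ℕ) : entry M i j ≤ 1 := by
  unfold entry
  split_ifs
  · omega
  · omega

theorem mem_of_entry_eq_one {i j : ℕ} (h : entry M i j = 1) : (i, j) ∈ F := by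
  by_contra h'
  simp [entry, h'] at h

theorem label_zero_left (M : Filling F) (j : ℕ) : label M 0 j = fun _ => 0 := by
  rw [label]

theorem label_zero_right (M : Filling F) (i : ℕ) : label M i 0 = fun _ => 0 := by
  cases i <;> rw [label]

theorem label_succ_succ (M : Filling F) (i j : ℕ) : label M (i + 1) (j + 1) =
    forward (entry M i j) (label M i j) (label M i (j + 1)) (label M (i + 1) j) := by
  rw [label]

/-- Induction on the height: the strips at height `i` yield the vertical edges above them from left
to right, and the resulting cells yield the strips at height `i + 1`. A vertical edge adds a square
exactly when the 1 of its row lies to its left. -/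
theorem label_edges (hM : ∀ i j j', entry M i j = 1 → entry M i j' = 1 → j = j') (i : ℕ) :
    (∀ j, Strip (label M i j) (label M i (j + 1))) ∧
      ∀ j, (∃ j' < j, entry M i j' = 1) ∧ Incr (label M i j) (label M (i + 1) j) ∨
        (∀ j' < j, entry M i j' = 0) ∧ label M (i + 1) j = label M i j := by
  have cell : ∀ i, (∀ j, Strip (label M i j) (label M i (j + 1))) → ∀ j,
      ((∃ j' < j, entry M i j' = 1) ∧ Incr (label M i j) (label M (i + 1) j) ∨
        (∀ j' < j, entry M i j' = 0) ∧ label M (i + 1) j = label M i j) →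
      Antitone (label M (i + 1) j) →
      IsCell (entry M i j) (label M i j) (label M i (j + 1)) (label M (i + 1) j)
        (label M (i + 1) (j + 1)) := by
    intro i hs j hj ha
    refine ⟨entry_le_one M i j, hs j, ha, ?_, label_succ_succ M i j⟩
    rcases hj with ⟨⟨j', hj', h1⟩, h⟩ | ⟨_, h⟩
    · refine Or.inr ⟨h, ?_⟩
      have := entry_le_one M i j
      by_contra h0
      have := hM i j j' (by omega) h1
      omega
    · exact Or.inl h
  -- The strips at height `i + 1` are not yet available, so antitonicity of the top labels is
  -- carried along.
  have vert : ∀ i, (∀ j, Strip (label M i j) (label M i (j + 1))) → ∀ j,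
      ((∃ j' < j, entry M i j' = 1) ∧ Incr (label M i j) (label M (i + 1) j) ∨
        (∀ j' < j, entry M i j' = 0) ∧ label M (i + 1) j = label M i j) ∧
      Antitone (label M (i + 1) j) := by
    intro i hs j
    induction j with
    | zero =>
      refine ⟨Or.inr ⟨by simp, by rw [label_zero_right, label_zero_right]⟩, ?_⟩
      rw [label_zero_right]
      exact antitone_const
    | succ j ih =>
      have hc := cell i hs j ih.1 ih.2
      refine ⟨?_, hc.top.antitone_right⟩
      rcases ih.1 with ⟨⟨j', hj', h1⟩, h⟩ | ⟨h0, h⟩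
      · exact Or.inl ⟨⟨j', by omega, h1⟩, (hc.right_of_incr h).2⟩
      · rcases Nat.le_one_iff_eq_zero_or_eq_one.1 (entry_le_one M i j) with he | he
        · refine Or.inr ⟨?_, ?_⟩
          · intro j' hj'
            rcases Nat.lt_succ_iff_lt_or_eq.1 hj' with h' | rfl
            · exact h0 j' h'
            · exact he
          · rw [he, h] at hc
            exact hc.right_of_zero
        · refine Or.inl ⟨⟨j, by omega, he⟩, ?_⟩
          rw [he] at hc
          exact hc.right_of_one.2
  have hs : ∀ j, Strip (label M i j) (label M i (j + 1)) := by
    induction i with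
    | zero =>
      intro j r
      simp [label_zero_left]
    | succ i ih => exact fun j => (cell i ih j (vert i ih j).1 (vert i ih j).2).top
  exact ⟨hs, fun j => (vert i hs j).1⟩

theorem label_strip (hM : ∀ i j j', entry M i j = 1 → entry M i j' = 1 → j = j') (i j : ℕ) :
    Strip (label M i j) (label M i (j + 1)) :=
  (label_edges hM i).1 j

theorem label_isCell (hM : ∀ i j j', entry M i j = 1 → entry M i j' = 1 → j = j') (i j : ℕ) :
    IsCell (entry M i j) (label M i j) (label M i (j + 1)) (label M (i + 1) j)
        (label M (i + 1) (j + 1)) := by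
  refine ⟨entry_le_one M i j, label_strip hM i j, (label_strip hM (i + 1) j).antitone_left, ?_,
    label_succ_succ M i j⟩
  rcases (label_edges hM i).2 j with ⟨⟨j', hj', h1⟩, h⟩ | ⟨_, h⟩
  · refine Or.inr ⟨h, ?_⟩
    have := entry_le_one M i j
    by_contra h0
    have := hM i j j' (by omega) h1
    omega
  · exact Or.inl h

/-- A horizontal strip creates at most one new row, which bounds the number of parts by the
horizontal position. -/
theorem label_eq_zero (hM : ∀ i j j', entry M i j = 1 → entry M i j' = 1 → j = j') (i j r : ℕ)
    (hr : j ≤ r) : label M i j r = 0 := by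
  induction j generalizing r with
  | zero => rw [label_zero_right]
  | succ j ih =>
    obtain ⟨r, rfl⟩ : ∃ r', r = r' + 1 := ⟨r - 1, by omega⟩
    have := (label_strip hM i j r).2
    rw [ih r (by omega)] at this
    omega

/-! ### First parts and chains -/

/-- This is the recurrence for the longest NE-chain in the rectangle below and to the left of a
corner: a 1 in the cell extends chains in strictly lower rows and weakly smaller columns. -/
theorem label_succ_succ_first (M : Filling F) (i j : ℕ) : label M (i + 1) (j + 1) 0 =
    max (label M i (j + 1) 0 + entry M i j) (label M (i + 1) j 0) := by
  rw [label_succ_succ, forward, carry]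

theorem label_first_mono {i i' j j' : ℕ} (hi : i ≤ i') (hj : j ≤ j') :
    label M i j 0 ≤ label M i' j' 0 := by
  have h1 : Monotone fun i => label M i j 0 := by
    refine monotone_nat_of_le_succ fun i => ?_
    cases j with
    | zero => simp [label_zero_right]
    | succ j =>
      rw [label_succ_succ_first]
      omega
  have h2 : Monotone fun j => label M i' j 0 := by
    refine monotone_nat_of_le_succ fun j => ?_
    cases i' with
    | zero => simp [label_zero_left]
    | succ i =>
      rw [label_succ_succ_first]
      omega
  exact (h1 hi).trans (h2 hj)

theorem length_le_label {l : List (ℕ × ℕ)} {c : ℕ × ℕ} (h : IsNEChain M (l ++ [c])) :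
    l.length + 1 ≤ label M (c.1 + 1) (c.2 + 1) 0 := by
  induction l using List.reverseRecOn generalizing c with
  | nil =>
    have := h.1 c (by simp)
    rw [label_succ_succ_first]
    simp
    omega
  | append_singleton l d ih =>
    have h1 := h.1 c (by simp)
    have hch := h.2
    rw [List.isChain_append] at hch
    have hd : IsNEChain M (l ++ [d]) :=
      ⟨fun x hx => h.1 x (List.mem_append_left _ hx), hch.1⟩
    have hdc := hch.2.2 d (by simp) c (by simp)
    have h2 := ih hd
    have h3 : label M (d.1 + 1) (d.2 + 1) 0 ≤ label M c.1 (c.2 + 1) 0 :=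
      label_first_mono (by omega) (by omega)
    rw [label_succ_succ_first]
    simp
    omega

theorem exists_chain (M : Filling F) (i j : ℕ) : ∃ l : List (ℕ × ℕ), IsNEChain M l ∧
    l.length = label M i j 0 ∧ ∀ c ∈ l, c.1 < i ∧ c.2 < j := by
  induction i generalizing j with
  | zero => exact ⟨[], ⟨by simp, by simp⟩, by simp [label_zero_left], by simp⟩
  | succ i ihi =>
    induction j with
    | zero => exact ⟨[], ⟨by simp, by simp⟩, by simp [label_zero_right], by simp⟩
    | succ j ihj =>
      rw [label_succ_succ_first]
      rcases max_choice (label M i (j + 1) 0 + entry M i j) (label M (i + 1) j 0) with h | h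
      · rw [h]
        obtain ⟨l, h1, h2, h3⟩ := ihi (j + 1)
        rcases Nat.le_one_iff_eq_zero_or_eq_one.1 (entry_le_one M i j) with he | he
        · refine ⟨l, h1, by omega, fun c hc => ?_⟩
          have := h3 c hc
          omega
        · refine ⟨l ++ [(i, j)], ⟨?_, ?_⟩, by simp [h2, he], ?_⟩
          · intro c hc
            rcases List.mem_append.1 hc with hc | hc
            · exact h1.1 c hc
            · rw [List.mem_singleton.1 hc]
              exact he
          · rw [List.isChain_append]
            refine ⟨h1.2, by simp, ?_⟩
            intro x hx y hy
            have hx := h3 x (List.mem_of_mem_getLast? hx)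
            simp at hy
            subst hy
            exact ⟨hx.1, by simpa using Nat.lt_succ_iff.1 hx.2⟩
          · intro c hc
            rcases List.mem_append.1 hc with hc | hc
            · have := h3 c hc
              omega
            · rw [List.mem_singleton.1 hc]
              simp
      · rw [h]
        obtain ⟨l, h1, h2, h3⟩ := ihj
        refine ⟨l, h1, h2, fun c hc => ?_⟩
        have := h3 c hc
        omega

theorem label_first_le {k : ℕ} (h : ¬ ∃ l : List (ℕ × ℕ), IsNEChain M l ∧ l.length = k + 1)
    (i j : ℕ) : label M i j 0 ≤ k := by
  by_contra hk
  obtain ⟨l, h1, h2, -⟩ := exists_chain M i j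
  -- Only length exactly `k + 1` is excluded, so a longer chain is truncated.
  refine h ⟨l.take (k + 1), ⟨fun c hc => h1.1 c (List.mem_of_mem_take hc), h1.2.take _⟩, ?_⟩
  rw [List.length_take]
  omega

end Label

/-! ### Young diagrams and their row lengths -/

/-- The Young diagram with the given parts, if these are decreasing and vanish from `N` on. -/
def diagramOfParts (N : ℕ) (f : ℕ → ℕ) (hf : Antitone f) : YoungDiagram where
  cells := (Finset.range N ×ˢ Finset.range (f 0)).filter fun c => c.2 < f c.1
  isLowerSet := by
    rintro ⟨a, b⟩ ⟨c, d⟩ h hab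
    obtain ⟨h1, h2⟩ := Prod.mk_le_mk.1 h
    simp only [Finset.coe_filter, Finset.mem_product, Finset.mem_range, Set.mem_ofPred_eq] at hab ⊢
    have := hf h1
    omega

theorem rowLen_diagramOfParts {N : ℕ} {f : ℕ → ℕ} (hf : Antitone f) (h0 : ∀ r, N ≤ r → f r = 0)
    (r : ℕ) : (diagramOfParts N f hf).rowLen r = f r := by
  have key : ∀ j, j < (diagramOfParts N f hf).rowLen r ↔ j < f r := by
    intro j
    rw [← YoungDiagram.mem_iff_lt_rowLen, ← YoungDiagram.mem_cells]
    simp only [diagramOfParts, Finset.mem_filter, Finset.mem_product, Finset.mem_range]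
    refine ⟨fun h => h.2, fun h => ⟨⟨?_, h.trans_le (hf (Nat.zero_le r))⟩, h⟩⟩
    by_contra hr
    rw [h0 r (by omega)] at h
    omega
  exact eq_of_forall_lt_iff key

theorem ext_rowLen {μ ν : YoungDiagram} (h : ∀ r, μ.rowLen r = ν.rowLen r) : μ = ν := by
  refine YoungDiagram.ext (Finset.ext ?_)
  rintro ⟨i, j⟩
  rw [YoungDiagram.mem_cells, YoungDiagram.mem_cells, YoungDiagram.mem_iff_lt_rowLen,
    YoungDiagram.mem_iff_lt_rowLen, h]

theorem rowLen_bot (r : ℕ) : (⊥ : YoungDiagram).rowLen r = 0 := by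
  by_contra h
  exact YoungDiagram.notMem_bot (r, 0)
    (YoungDiagram.mem_iff_lt_rowLen.2 (Nat.pos_of_ne_zero h))

theorem eq_bot_iff_rowLen {μ : YoungDiagram} : μ = ⊥ ↔ μ.rowLen = fun _ => 0 := by
  constructor
  · rintro rfl
    exact funext rowLen_bot
  · intro h
    refine ext_rowLen fun r => ?_
    rw [h, rowLen_bot]

theorem addsHorizontalStrip_iff {μ ν : YoungDiagram} :
    AddsHorizontalStrip μ ν ↔ Strip μ.rowLen ν.rowLen := by
  constructor
  · rintro ⟨h1, h2⟩ r
    constructor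
    · by_contra h
      have hm : (r, ν.rowLen r) ∈ ν :=
        h1 (YoungDiagram.mem_iff_lt_rowLen.2 (not_le.1 h))
      exact lt_irrefl _ (YoungDiagram.mem_iff_lt_rowLen.1 hm)
    · by_contra h
      have ha : (r + 1, μ.rowLen r) ∈ ν := YoungDiagram.mem_iff_lt_rowLen.2 (not_le.1 h)
      have hb : (r, μ.rowLen r) ∈ ν := ν.up_left_mem (Nat.le_succ r) le_rfl ha
      have hb' : (r, μ.rowLen r) ∉ μ := by simp [YoungDiagram.mem_iff_lt_rowLen]
      have ha' : (r + 1, μ.rowLen r) ∉ μ :=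
        fun h => hb' (μ.up_left_mem (Nat.le_succ r) le_rfl h)
      have := h2 _ ha ha' _ hb hb' rfl
      simp at this
  · intro h
    constructor
    · rintro ⟨i, j⟩ hij
      simp only [YoungDiagram.mem_iff_lt_rowLen] at hij ⊢
      exact hij.trans_le (h i).1
    · rintro ⟨i, j⟩ hc hc' ⟨i', j'⟩ hd hd' e
      simp only at e
      subst e
      rw [YoungDiagram.mem_iff_lt_rowLen] at *
      have key : ∀ a b, a < b → j < ν.rowLen b → j < μ.rowLen a := by
        intro a b hab hb
        have h1 := ν.rowLen_anti (a + 1) b hab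
        have h2 := (h a).2
        omega
      rcases lt_trichotomy i i' with h' | rfl | h'
      · exact absurd (key _ _ h' hd) hc'
      · rfl
      · exact absurd (key _ _ h' hc) hd'

theorem strip_of_eq_or_adds {μ ν : YoungDiagram} (h : ν = μ ∨ AddsHorizontalStrip μ ν) :
    Strip μ.rowLen ν.rowLen := by
  rcases h with rfl | h
  · exact fun r => ⟨le_rfl, ν.rowLen_anti _ _ (Nat.le_succ r)⟩
  · exact addsHorizontalStrip_iff.1 h

theorem deletesSquare_iff {μ ν : YoungDiagram} :
    DeletesSquare μ ν ↔ Incr ν.rowLen μ.rowLen := by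
  constructor
  · rintro ⟨⟨a, b⟩, hc, h⟩
    have key : ∀ i j, j < ν.rowLen i ↔ ¬ (i = a ∧ j = b) ∧ j < μ.rowLen i := by
      intro i j
      rw [← YoungDiagram.mem_iff_lt_rowLen, ← YoungDiagram.mem_iff_lt_rowLen,
        ← YoungDiagram.mem_cells, h, Finset.mem_erase, YoungDiagram.mem_cells]
      simp
    rw [YoungDiagram.mem_iff_lt_rowLen] at hc
    refine ⟨a, fun r => ?_⟩
    by_cases e : r = a
    · subst e
      -- Columns `b` and `b + 1` bound the two row lengths from above; the first column outside `ν`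
      -- must be the erased one.
      have h1 := key r b
      have h2 := key r (ν.rowLen r)
      have h3 := key r (b + 1)
      simp at h1 h2 h3 ⊢
      have : ν.rowLen r = b := by
        by_contra hne
        have := h2 hne
        omega
      omega
    · simpa [e] using (eq_of_forall_lt_iff fun j => by simpa [e] using key r j :
        ν.rowLen r = μ.rowLen r).symm
  · rintro ⟨s, hs⟩
    refine ⟨(s, ν.rowLen s), ?_, ?_⟩
    · rw [YoungDiagram.mem_iff_lt_rowLen, hs]
      simp
    · ext ⟨i, j⟩
      rw [Finset.mem_erase, YoungDiagram.mem_cells, YoungDiagram.mem_cells,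
        YoungDiagram.mem_iff_lt_rowLen, YoungDiagram.mem_iff_lt_rowLen, hs i]
      by_cases e : i = s
      · subst e
        simp
        omega
      · simp [e]

/-! ### The border of a filling -/

section Border

variable {n k : ℕ} {M : Filling (triangle n)}

theorem OneInEachRow.unique (hM : OneInEachRow M) (i j j' : ℕ) (h : entry M i j = 1)
    (h' : entry M i j' = 1) : j = j' := by
  have := mem_triangle.1 (mem_of_entry_eq_one h)
  exact (hM i (by omega)).unique h h'

theorem borderLabel_even (M : Filling (triangle n)) (i : ℕ) :
    borderLabel M (2 * i) = label M (n - i) i := by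
  rw [borderLabel, show 2 * i / 2 = i by omega, show (2 * i + 1) / 2 = i by omega]

theorem borderLabel_odd (M : Filling (triangle n)) (i : ℕ) :
    borderLabel M (2 * i + 1) = label M (n - i) (i + 1) := by
  rw [borderLabel, show (2 * i + 1) / 2 = i by omega, show (2 * i + 1 + 1) / 2 = i + 1 by omega]

theorem borderLabel_strip (hM : OneInEachRow M) (i : ℕ) :
    Strip (borderLabel M (2 * i)) (borderLabel M (2 * i + 1)) := by
  rw [borderLabel_even, borderLabel_odd]
  exact label_strip hM.unique _ _

/-- All cells of the row lie to the left of its border edge, and so does its 1. -/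
theorem borderLabel_incr (hM : OneInEachRow M) {i : ℕ} (hi : i < n) :
    Incr (borderLabel M (2 * i + 2)) (borderLabel M (2 * i + 1)) := by
  rw [show 2 * i + 2 = 2 * (i + 1) by omega, borderLabel_even, borderLabel_odd]
  obtain ⟨p, hp⟩ : ∃ p, p = n - (i + 1) := ⟨_, rfl⟩
  rw [← hp, show n - i = p + 1 by omega]
  rcases (label_edges hM.unique p).2 (i + 1) with h | h
  · exact h.2
  · obtain ⟨j, hj, -⟩ := hM p (by omega)
    have := mem_triangle.1 (mem_of_entry_eq_one hj)
    have := h.1 j (by omega)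
    omega

theorem borderLabel_antitone (hM : OneInEachRow M) (t : ℕ) : Antitone (borderLabel M t) :=
  (label_strip hM.unique _ _).antitone_left

/-- The border of a filling as a sequence of Young diagrams. -/
def border (hM : OneInEachRow M) (t : Fin (2 * n + 1)) : YoungDiagram :=
  diagramOfParts ((t + 1) / 2) (borderLabel M t) (borderLabel_antitone hM t)

theorem rowLen_border (hM : OneInEachRow M) (t : Fin (2 * n + 1)) :
    (border hM t).rowLen = borderLabel M t :=
  funext (rowLen_diagramOfParts _ (label_eq_zero hM.unique _ _))

theorem isStripSequence_border (hM : OneInEachRow M)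
    (hk : ¬ ∃ l : List (ℕ × ℕ), IsNEChain M l ∧ l.length = k + 1) :
    IsStripSequence n k (border hM) where
  first := by
    rw [eq_bot_iff_rowLen, rowLen_border]
    exact (borderLabel_even M 0).trans (label_zero_right M _)
  last := by
    rw [eq_bot_iff_rowLen, rowLen_border, borderLabel_even, Nat.sub_self]
    exact label_zero_left M _
  columns t := by
    rw [rowLen_border]
    exact label_first_le hk _ _
  odd_step i hi := by
    rw [addsHorizontalStrip_iff, rowLen_border, rowLen_border]
    exact Or.inr (borderLabel_strip hM i)
  even_step i hi := by
    rw [deletesSquare_iff, rowLen_border, rowLen_border]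
    exact borderLabel_incr hM hi

theorem no_chain_of_borderLabel_le (h : ∀ t < 2 * n, borderLabel M t 0 ≤ k) :
    ¬ ∃ l : List (ℕ × ℕ), IsNEChain M l ∧ l.length = k + 1 := by
  rintro ⟨l, hl, hk⟩
  obtain rfl | ⟨l, c, rfl⟩ := l.eq_nil_or_concat'
  · simp at hk
  have hc := mem_triangle.1 (mem_of_entry_eq_one (hl.1 c (by simp)))
  have h1 := length_le_label hl
  -- The border corner at the top right of the last cell's column; the whole chain lies below and to
  -- the left of it.
  have h2 := h (2 * c.2 + 1) (by omega)
  rw [borderLabel_odd] at h2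
  have h3 : label M (c.1 + 1) (c.2 + 1) 0 ≤ label M (n - c.2) (c.2 + 1) 0 :=
    label_first_mono (by omega) le_rfl
  simp at hk
  omega

theorem label_eq_of_borderLabel_eq {M' : Filling (triangle n)} (hM : OneInEachRow M)
    (hM' : OneInEachRow M') (h : ∀ t ≤ 2 * n, borderLabel M t = borderLabel M' t) (d : ℕ) :
    ∀ i j, n ≤ i + j + d → i + j ≤ n + 1 → label M i j = label M' i j := by
  induction d with
  | zero =>
    intro i j h1 h2
    -- The corners `(n + 1, 0)` and `(0, n + 1)` satisfy the bounds but lie off the border.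
    rcases Nat.eq_zero_or_pos j with rfl | hj
    · rw [label_zero_right, label_zero_right]
    rcases Nat.eq_zero_or_pos i with rfl | hi
    · rw [label_zero_left, label_zero_left]
    have := h (n + j - i) (by omega)
    rwa [borderLabel, borderLabel, show n - (n + j - i) / 2 = i by omega,
      show (n + j - i + 1) / 2 = j by omega] at this
  | succ d ih =>
    intro i j h1 h2
    by_cases h3 : n ≤ i + j + d
    · exact ih i j h3 h2
    rw [((label_isCell hM.unique i j).eq_pullback).1, ((label_isCell hM'.unique i j).eq_pullback).1,
      ih i (j + 1) (by omega) (by omega), ih (i + 1) j (by omega) (by omega),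
      ih (i + 1) (j + 1) (by omega) (by omega)]

theorem eq_of_borderLabel_eq {M' : Filling (triangle n)} (hM : OneInEachRow M)
    (hM' : OneInEachRow M') (h : ∀ t ≤ 2 * n, borderLabel M t = borderLabel M' t) : M = M' := by
  have hl := fun i j => label_eq_of_borderLabel_eq hM hM' h n i j (by omega)
  funext ⟨⟨i, j⟩, hc⟩
  have hij := mem_triangle.1 hc
  simp only at hij
  have he : entry M i j = entry M' i j := by
    rw [((label_isCell hM.unique i j).eq_pullback).2, ((label_isCell hM'.unique i j).eq_pullback).2,
      hl i (j + 1) (by omega), hl (i + 1) j (by omega), hl (i + 1) (j + 1) (by omega)]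
  rw [entry, entry, dif_pos hc, dif_pos hc] at he
  exact Fin.ext he

end Border

/-! ### The filling with a given border -/

section Inverse

/-- The labels determined by the labels `b` along the border of the triangular shape. -/
def grid (n : ℕ) (b : ℕ → ℕ → ℕ) (i j : ℕ) : ℕ → ℕ :=
  if n ≤ i + j then b (n + j - i)
  else pullback (grid n b i (j + 1)) (grid n b (i + 1) j) (grid n b (i + 1) (j + 1))
termination_by n - (i + j)

/-- The properties of the labels along the border, continued by empty partitions. -/
structure IsBorder (n : ℕ) (b : ℕ → ℕ → ℕ) : Prop where
  first : b 0 = fun _ => 0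
  last : ∀ t, 2 * n ≤ t → b t = fun _ => 0
  strip : ∀ i < n, Strip (b (2 * i)) (b (2 * i + 1))
  incr : ∀ i < n, Incr (b (2 * i + 2)) (b (2 * i + 1))

variable {n : ℕ} {b : ℕ → ℕ → ℕ}

theorem grid_of_le {i j : ℕ} (h : n ≤ i + j) : grid n b i j = b (n + j - i) := by
  rw [grid, if_pos h]

theorem grid_of_lt {i j : ℕ} (h : i + j < n) : grid n b i j =
    pullback (grid n b i (j + 1)) (grid n b (i + 1) j) (grid n b (i + 1) (j + 1)) := by
  rw [grid, if_neg (not_le.2 h)]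

theorem grid_edges (hb : IsBorder n b) (d : ℕ) : ∀ i j, i + j + d = n →
    Strip (grid n b i j) (grid n b i (j + 1)) ∧
      (grid n b (i + 1) j = grid n b i j ∨ Incr (grid n b i j) (grid n b (i + 1) j)) := by
  induction d with
  | zero =>
    intro i j h
    rw [grid_of_le (by omega), grid_of_le (by omega), grid_of_le (by omega),
      show n + j - i = 2 * j by omega, show n + (j + 1) - i = 2 * j + 1 by omega]
    constructor
    · by_cases hj : j < n
      · exact hb.strip j hj
      -- The edge just beyond the bottom-right corner, where the border is continued by empty
      -- partitions.
      · rw [hb.last _ (by omega), hb.last _ (by omega)]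
        exact fun r => ⟨le_rfl, le_rfl⟩
    · cases j with
      | zero =>
        -- By truncated subtraction, the corner `(n + 1, 0)` also receives `b 0`.
        rw [show n + 0 - (i + 1) = 2 * 0 by omega]
        exact Or.inl rfl
      | succ j =>
        rw [show n + (j + 1) - (i + 1) = 2 * j + 1 by omega]
        exact Or.inr (hb.incr j (by omega))
  | succ d ih =>
    intro i j h
    have h1 := ih i (j + 1) (by omega)
    have h2 := ih (i + 1) j (by omega)
    have hc := IsCell.of_top_right h2.1 h1.1.antitone_left h1.2
    rw [← grid_of_lt (by omega)] at hc
    exact ⟨hc.bottom, hc.left.imp id And.left⟩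

theorem grid_isCell (hb : IsBorder n b) {i j : ℕ} (h : i + j < n) :
    IsCell (pullbackEntry (grid n b i (j + 1)) (grid n b (i + 1) j) (grid n b (i + 1) (j + 1)))
      (grid n b i j) (grid n b i (j + 1)) (grid n b (i + 1) j) (grid n b (i + 1) (j + 1)) := by
  have h1 := grid_edges hb (n - (i + j + 1)) i (j + 1) (by omega)
  have h2 := grid_edges hb (n - (i + j + 1)) (i + 1) j (by omega)
  rw [grid_of_lt h]
  exact IsCell.of_top_right h2.1 h1.1.antitone_left h1.2

/-- Each bottom label is contained in its right neighbour, and far enough to the right all are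
empty. -/
theorem grid_zero_left (hb : IsBorder n b) (j : ℕ) : grid n b 0 j = fun _ => 0 := by
  have key : ∀ d j, n ≤ j + d → grid n b 0 j = fun _ => 0 := by
    intro d
    induction d with
    | zero =>
      intro j h
      rw [grid_of_le (by omega), hb.last _ (by omega)]
    | succ d ih =>
      intro j h
      by_cases h' : n ≤ j + d
      · exact ih j h'
      have h1 := (grid_edges hb (n - j) 0 j (by omega)).1
      rw [ih (j + 1) (by omega)] at h1
      funext r
      exact Nat.le_zero.1 (h1 r).1
  exact key n j (by omega)

theorem grid_zero_right (hb : IsBorder n b) (i : ℕ) : grid n b i 0 = fun _ => 0 := by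
  have key : ∀ d i, n ≤ i + d → grid n b i 0 = fun _ => 0 := by
    intro d
    induction d with
    | zero =>
      intro i h
      rw [grid_of_le (by omega), show n + 0 - i = 0 by omega, hb.first]
    | succ d ih =>
      intro i h
      by_cases h' : n ≤ i + d
      · exact ih i h'
      have h1 := (grid_edges hb (n - i) i 0 (by omega)).2
      rw [ih (i + 1) (by omega)] at h1
      rcases h1 with h1 | ⟨s, hs⟩
      · exact h1.symm
      · have := hs s
        simp at this
  exact key n i (by omega)

theorem pullbackEntry_lt (μ υ ν : ℕ → ℕ) : pullbackEntry μ υ ν < 2 := by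
  unfold pullbackEntry
  split_ifs <;> omega

/-- The filling determined by the labels `b` along the border of the triangular shape. -/
def fillingOfBorder (n : ℕ) (b : ℕ → ℕ → ℕ) : Filling (triangle n) := fun c =>
  ⟨pullbackEntry (grid n b c.1.1 (c.1.2 + 1)) (grid n b (c.1.1 + 1) c.1.2)
    (grid n b (c.1.1 + 1) (c.1.2 + 1)), pullbackEntry_lt _ _ _⟩

theorem entry_fillingOfBorder {i j : ℕ} (h : i + j < n) : entry (fillingOfBorder n b) i j =
    pullbackEntry (grid n b i (j + 1)) (grid n b (i + 1) j) (grid n b (i + 1) (j + 1)) := by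
  rw [entry, dif_pos (mem_triangle.2 h)]
  rfl

theorem label_fillingOfBorder (hb : IsBorder n b) (i j : ℕ) (h : i + j ≤ n + 1) :
    label (fillingOfBorder n b) i j = grid n b i j := by
  induction i generalizing j with
  | zero => rw [label_zero_left, grid_zero_left hb]
  | succ i ihi =>
    induction j with
    | zero => rw [label_zero_right, grid_zero_right hb]
    | succ j ihj =>
      rw [label_succ_succ, ihi j (by omega), ihi (j + 1) (by omega), ihj (by omega),
        entry_fillingOfBorder (by omega)]
      exact (grid_isCell hb (by omega)).eq_forward.symm

theorem borderLabel_fillingOfBorder (hb : IsBorder n b) {t : ℕ} (ht : t ≤ 2 * n) :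
    borderLabel (fillingOfBorder n b) t = b t := by
  rw [borderLabel, label_fillingOfBorder hb _ _ (by omega), grid_of_le (by omega)]
  congr 1
  omega

theorem oneInEachRow_fillingOfBorder (hb : IsBorder n b) :
    OneInEachRow (fillingOfBorder n b) := by
  intro i hi
  have hstep : ∀ j, i + j < n → Incr (grid n b i j) (grid n b (i + 1) j) →
      entry (fillingOfBorder n b) i j = 0 ∧
        Incr (grid n b i (j + 1)) (grid n b (i + 1) (j + 1)) := by
    intro j h hj
    rw [entry_fillingOfBorder h]
    exact (grid_isCell hb h).right_of_incr hj
  have hone : ∀ j, i + j < n → entry (fillingOfBorder n b) i j = 1 →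
      Incr (grid n b i (j + 1)) (grid n b (i + 1) (j + 1)) := by
    intro j h hj
    have hc := grid_isCell hb h
    rw [← entry_fillingOfBorder h, hj] at hc
    exact hc.right_of_one.2
  -- Once a vertical edge adds a square, all later ones in the row do, and the entries passed are 0.
  -- This excludes a second 1.
  have hmono : ∀ j j', j ≤ j' → i + j' ≤ n → Incr (grid n b i j) (grid n b (i + 1) j) →
      Incr (grid n b i j') (grid n b (i + 1) j') := by
    intro j j' hjj'
    induction hjj' with
    | refl => exact fun _ h => h
    | step _ ih => exact fun h hj => (hstep _ (by omega) (ih (by omega) hj)).2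
  have hlt : ∀ j j', entry (fillingOfBorder n b) i j = 1 →
      entry (fillingOfBorder n b) i j' = 1 → ¬ j < j' := by
    intro j j' h h' hjj'
    have hm := mem_triangle.1 (mem_of_entry_eq_one h)
    have hm' := mem_triangle.1 (mem_of_entry_eq_one h')
    simp only at hm hm'
    have := (hstep j' hm' (hmono (j + 1) j' hjj' hm'.le (hone j hm h))).1
    omega
  refine existsUnique_of_exists_of_unique ?_ fun j j' h h' => ?_
  · by_contra hne
    push Not at hne
    -- Without a 1, the trivial edge on the left side would propagate to the border, where a square
    -- must be added.
    have hz : ∀ j, i + j ≤ n → grid n b (i + 1) j = grid n b i j := by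
      intro j
      induction j with
      | zero => exact fun _ => by rw [grid_zero_right hb, grid_zero_right hb]
      | succ j ih =>
        intro h
        have hc := grid_isCell hb (show i + j < n by omega)
        have he := entry_le_one (fillingOfBorder n b) i j
        have he' := hne j
        rw [← entry_fillingOfBorder (by omega), ih (by omega),
          show entry (fillingOfBorder n b) i j = 0 by omega] at hc
        exact hc.right_of_zero
    have h := hz (n - i) (by omega)
    rw [grid_of_le (by omega), grid_of_le (by omega),
      show n + (n - i) - (i + 1) = 2 * (n - i - 1) + 1 by omega,
      show n + (n - i) - i = 2 * (n - i - 1) + 2 by omega] at h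
    exact (hb.incr (n - i - 1) (by omega)).ne h
  · exact le_antisymm (not_lt.1 (hlt _ _ h' h)) (not_lt.1 (hlt _ _ h h'))

end Inverse

/-! ### The bijection -/

/-- The parts of the members of a sequence of Young diagrams, continued by empty partitions. -/
def partsOfSequence {n : ℕ} (s : Fin (2 * n + 1) → YoungDiagram) (t : ℕ) : ℕ → ℕ :=
  if h : t < 2 * n + 1 then (s ⟨t, h⟩).rowLen else fun _ => 0

theorem IsStripSequence.isBorder {n k : ℕ} {s : Fin (2 * n + 1) → YoungDiagram}
    (hs : IsStripSequence n k s) : IsBorder n (partsOfSequence s) where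
  first := by
    rw [partsOfSequence, dif_pos (by omega), ← eq_bot_iff_rowLen, hs.first]
  last t ht := by
    unfold partsOfSequence
    split_ifs with h
    · obtain rfl : t = 2 * n := by omega
      rw [← eq_bot_iff_rowLen, hs.last]
    · rfl
  strip i hi := by
    rw [partsOfSequence, partsOfSequence, dif_pos (by omega), dif_pos (by omega)]
    exact strip_of_eq_or_adds (hs.odd_step i hi)
  incr i hi := by
    rw [partsOfSequence, partsOfSequence, dif_pos (by omega), dif_pos (by omega)]
    exact deletesSquare_iff.1 (hs.even_step i hi)

theorem border_bijective (n k : ℕ) : Function.Bijective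
    (fun M => ⟨border M.2.1, isStripSequence_border M.2.1 M.2.2⟩ :
      {M : Filling (triangle n) // OneInEachRow M ∧
        ¬ ∃ l : List (ℕ × ℕ), IsNEChain M l ∧ l.length = k + 1} →
      {s : Fin (2 * n + 1) → YoungDiagram // IsStripSequence n k s}) := by
  constructor
  · rintro ⟨M, hM, hk⟩ ⟨M', hM', hk'⟩ h
    refine Subtype.ext (eq_of_borderLabel_eq hM hM' fun t ht => ?_)
    have h1 := congrFun (Subtype.ext_iff.1 h) ⟨t, by omega⟩
    have h2 := congrArg YoungDiagram.rowLen h1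
    simpa only [rowLen_border] using h2
  · rintro ⟨s, hs⟩
    have hb := hs.isBorder
    have hl : ∀ t (ht : t < 2 * n + 1),
        borderLabel (fillingOfBorder n (partsOfSequence s)) t = (s ⟨t, ht⟩).rowLen := by
      intro t ht
      rw [borderLabel_fillingOfBorder hb (by omega), partsOfSequence, dif_pos ht]
    refine ⟨⟨fillingOfBorder n (partsOfSequence s), oneInEachRow_fillingOfBorder hb,
      no_chain_of_borderLabel_le fun t ht => ?_⟩, ?_⟩
    · rw [hl t (by omega)]
      exact hs.columns _
    · refine Subtype.ext (funext fun t => ext_rowLen fun r => ?_)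
      simp only [rowLen_border]
      rw [hl t t.2]

end GrowthDiagram

theorem mainTheorem5 (n k : ℕ) :
    ∃ Φ : {M : GrowthDiagram.Filling (GrowthDiagram.triangle n) //
            GrowthDiagram.OneInEachRow M ∧
              ¬ ∃ l : List (ℕ × ℕ), GrowthDiagram.IsNEChain M l ∧ l.length = k + 1} ≃
          {s : Fin (2 * n + 1) → YoungDiagram // GrowthDiagram.IsStripSequence n k s},
      ∀ M (t : Fin (2 * n + 1)) (r : ℕ),
        ((Φ M).1 t).rowLen r = GrowthDiagram.borderLabel M.1 t r := by
  refine ⟨Equiv.ofBijective _ (GrowthDiagram.border_bijective n k), fun M t r => ?_⟩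
  rw [← GrowthDiagram.rowLen_border M.2.1]
  rfl
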